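/- Let $X$ be a nonempty Tychonoff space, and let $C_p(X)$ be the space of continuous real-valued functions on $X$ with the topology of pointwise convergence. Notation. For families $\mathcal A,\mathcal B$ of subsets of a set, $S_1(\mathcal A,\mathcal B)$ says: for every sequence $(A_n)_{n\in\mathbb N}$ of members of $\mathcal A$ there are $b_n\in A_n$ with $\{b_n:n\in\mathbb N\}\in\mathcal B$; and $S_{fin}(\mathcal A,\mathcal B)$ says: for every such sequence there are finite sets $B_n\subseteq A_n$ with $\bigcup_n B_n\in\mathcal B$. For a topological space $Y$: * $\mathcal D$ is the family of dense subsets of $Y$, and $\mathcal S$ the family of sequentially dense subsets, i.e. those $D\subseteq Y$ such that every point of $Y$ is the limit of a sequence of points of $D$. * For $y\in Y$, $\Omega_y=\{A\subseteq Y: y\in\overline A\setminus A\}$, and $\Gamma_y$ is the family of infinite sets $A\subseteq Y$ with $y\notin A$ such that $A\setminus U$ is finite for every neighbourhood $U$ of $y$. * $\Omega$ is the family of open covers $\mathcal U$ of $Y$ with $Y\notin\mathcal U$ such that every finite subset of $Y$ is contained in a member of $\mathcal U$; $\Gamma$ is the family of infinite open covers $\mathcal U$ of $Y$ with $Y\notin\mathcal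 U$ such that each point of $Y$ belongs to all but finitely many members of $\mathcal U$. We write $Y\models S(\mathcal A,\mathcal B)$ when the principle holds for these families of $Y$; a principle that involves $\Omega_y$ or $\Gamma_y$ is required for every $y\in Y$ (written with subscript $x$ below, with $x$ ranging over the points of $C_p(X)$). The $i$-weight $iw(X)$ is the least infinite cardinal $\tau$ such that there is a one-to-one continuous map of $X$ onto a Tychonoff space of weight at most $\tau$. Then the following are equivalent: 1. $C_p(X)\models S_1(\mathcal D,\mathcal S)$; 2. every dense subset of $C_p(X)$ is sequentially dense, and $C_p(X)$ is separable; 3. $X\models S_1(\Omega,\Gamma)$ and $iw(X)=\aleph_0$; 4. $C_p(X)\models S_1(\Omega_x,\Gamma_x)$ and $C_p(X)$ is separable; 5. $C_p(X)\models S_1(\mathcal D,\Gamma_x)$ and $C_p(X)$ is separable; 6. $C_p(X)\models S_{fin}(\mathcal D,\mathcal S)$; 7. $X\models S_{fin}(\Omega,\Gamma)$ and $iw(X)=\aleph_0$; 8. $C_p(X)\models S_{fin}(\Omega_x,\Gamma_x)$ and $C_p(X)$ is separable; 9. $C_p(X)\models S_{fin}(\mathcal D,\Gamma_x)$ and $C_p(X)$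 is separable. -/

import Mathlib

open Topology Filter Cardinal

universe u

/-- The selection principle `S₁(𝒜, ℬ)`: from every sequence of members of `𝒜` one can pick one
element of each so that the set of the chosen elements is a member of `ℬ`. -/
def SelOne {α : Type u} (𝒜 ℬ : Set (Set α)) : Prop :=
  ∀ A : ℕ → Set α, (∀ n, A n ∈ 𝒜) →
    ∃ b : ℕ → α, (∀ n, b n ∈ A n) ∧ Set.range b ∈ ℬ

/-- The selection principle `S_fin(𝒜, ℬ)`: from every sequence of members of `𝒜` one can pick a
finite subset of each so that the union of the chosen subsets is a member of `ℬ`. -/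
def SelFin {α : Type u} (𝒜 ℬ : Set (Set α)) : Prop :=
  ∀ A : ℕ → Set α, (∀ n, A n ∈ 𝒜) →
    ∃ B : ℕ → Set α, (∀ n, (B n).Finite ∧ B n ⊆ A n) ∧ (⋃ n, B n) ∈ ℬ

/-- `𝒰` is a (nontrivial) open cover of `X`: its members are open and cover `X`, and `X` itself
is not a member. -/
def IsNontrivialOpenCover {X : Type u} [TopologicalSpace X] (𝒰 : Set (Set X)) : Prop :=
  (∀ U ∈ 𝒰, IsOpen U) ∧ ⋃₀ 𝒰 = Set.univ ∧ Set.univ ∉ 𝒰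

/-- `Ω`: the open `ω`-covers of `X`. -/
def OmegaCovers (X : Type u) [TopologicalSpace X] : Set (Set (Set X)) :=
  {𝒰 | IsNontrivialOpenCover 𝒰 ∧ ∀ F : Set X, F.Finite → ∃ U ∈ 𝒰, F ⊆ U}

/-- `Γ`: the open `γ`-covers of `X`. -/
def GammaCovers (X : Type u) [TopologicalSpace X] : Set (Set (Set X)) :=
  {𝒰 | IsNontrivialOpenCover 𝒰 ∧ 𝒰.Infinite ∧ ∀ x : X, {U ∈ 𝒰 | x ∉ U}.Finite}

/-- `𝒟`: the dense subsets of `Y`. -/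
def DenseSets (Y : Type u) [TopologicalSpace Y] : Set (Set Y) :=
  {D | Dense D}

/-- `𝒮`: the sequentially dense subsets of `Y`, those whose sequences have every point of `Y`
as a limit. -/
def SeqDenseSets (Y : Type u) [TopologicalSpace Y] : Set (Set Y) :=
  {D | seqClosure D = Set.univ}

/-- `Ω_y`: the sets `A` with `y ∈ closure A \ A`. -/
def OmegaAt {Y : Type u} [TopologicalSpace Y] (y : Y) : Set (Set Y) :=
  {A | y ∈ closure A \ A}

/-- `Γ_y`: the sets `A` that converge to `y`, that is, `A` is infinite, `y ∉ A`, and `A \ U` is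
finite for every neighbourhood `U` of `y`. -/
def GammaAt {Y : Type u} [TopologicalSpace Y] (y : Y) : Set (Set Y) :=
  {A | A.Infinite ∧ y ∉ A ∧ ∀ U ∈ 𝓝 y, (A \ U).Finite}

/-- Every dense subset of `Y` is sequentially dense. -/
def StronglySeqDenseInItself (Y : Type u) [TopologicalSpace Y] : Prop :=
  ∀ D ∈ DenseSets Y, D ∈ SeqDenseSets Y

/-- The weight of `Y`: the least cardinality of a base of its topology. -/
noncomputable def topWeight (Y : Type u) [TopologicalSpace Y] : Cardinal.{u} :=
  sInf {κ | ∃ B : Set (Set Y), TopologicalSpace.IsTopologicalBasis B ∧ #B = κ}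

/-- The `i`-weight of `X`: the least infinite cardinal `τ` such that `X` has a one-to-one
continuous mapping onto a Tychonoff space of weight at most `τ`. (Such a space is in bijection
with `X`, so it can be taken in the universe of `X`.) -/
noncomputable def iWeight (X : Type u) [TopologicalSpace X] : Cardinal.{u} :=
  sInf {τ | ℵ₀ ≤ τ ∧ ∃ (Y : Type u) (_ : TopologicalSpace Y) (f : X → Y),
    T35Space Y ∧ Continuous f ∧ Function.Bijective f ∧ topWeight Y ≤ τ}

/-- `C_p(X)`: the continuous real-valued functions on `X`, with the topology of pointwise
convergence (the subspace topology inherited from the product `X → ℝ`). -/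
abbrev Cp (X : Type u) [TopologicalSpace X] : Type u :=
  {f : X → ℝ // Continuous f}

/-! All nine conditions meet in `EventualSelection`, which is a property of `X` alone. Each
principle is stable under passing to a constant sequence of families, so already its `SelFin` form,
used on one set, says that dense sets of `Cp X` are sequentially dense, or that ω-covers of `X`
contain γ-covers. Functions equal to 1 off a member of an ω-cover form a dense set, and a sequence
of them tending to 0 traces a γ-cover (`StronglySeqDenseInItself.gammaProperty`). The Gerlits–Nagy
trick `GammaProperty.eventualSelection` upgrades one cover to a sequence of covers, and
`EventualSelection.exists_tendsto` carries this back to `Cp X`. Separately, `Cp X` is separable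
exactly when `X` has countable `i`-weight. -/

section Selection

variable {α : Type u}

lemma SelOne.selFin {𝒜 ℬ : Set (Set α)} (h : SelOne 𝒜 ℬ) : SelFin 𝒜 ℬ := by
  intro A hA
  obtain ⟨b, hb, hr⟩ := h A hA
  refine ⟨fun n => {b n}, fun n => ⟨Set.finite_singleton _, by simpa using hb n⟩, ?_⟩
  rwa [Set.iUnion_singleton_eq_range]

lemma SelFin.exists_countable_subset {𝒜 ℬ : Set (Set α)} (h : SelFin 𝒜 ℬ) {A : Set α}
    (hA : A ∈ 𝒜) : ∃ B ⊆ A, B.Countable ∧ B ∈ ℬ := by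
  obtain ⟨B, hB, hU⟩ := h (fun _ => A) (fun _ => hA)
  exact ⟨_, Set.iUnion_subset fun n => (hB n).2,
    Set.countable_iUnion fun n => (hB n).1.countable, hU⟩

end Selection

/-! ### Convergent sets and sequences in a general space -/

section Convergence

variable {Y : Type u} [TopologicalSpace Y]

lemma range_mem_gammaAt [T1Space Y] {y : Y} {b : ℕ → Y} (hne : ∀ n, b n ≠ y)
    (hb : Tendsto b atTop (𝓝 y)) : Set.range b ∈ GammaAt y := by
  have hy : y ∉ Set.range b := by
    rintro ⟨n, hn⟩
    exact hne n hn
  refine ⟨fun hfin => hy ?_, hy, fun U hU => ?_⟩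
  -- A finite range would be closed and so contain its limit.
  · exact hfin.isClosed.mem_of_tendsto hb (Eventually.of_forall fun n => ⟨n, rfl⟩)
  · have h : {n | b n ∉ U}.Finite := by
      have := hb.eventually hU
      rwa [← Nat.cofinite_eq_atTop, Filter.eventually_cofinite] at this
    refine (h.image b).subset ?_
    rintro _ ⟨⟨n, rfl⟩, hn⟩
    exact ⟨n, hn, rfl⟩

lemma exists_tendsto_of_mem_gammaAt {y : Y} {A : Set Y} (hA : A ∈ GammaAt y) :
    ∃ b : ℕ → Y, (∀ n, b n ∈ A) ∧ Tendsto b atTop (𝓝 y) := by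
  obtain ⟨hinf, -, hU⟩ := hA
  refine ⟨fun n => hinf.natEmbedding A n, fun n => (hinf.natEmbedding A n).2, fun U hUy => ?_⟩
  have hinj : Function.Injective fun n => (hinf.natEmbedding A n : Y) :=
    Subtype.val_injective.comp (hinf.natEmbedding A).injective
  rw [← Nat.cofinite_eq_atTop, Filter.mem_map, Filter.mem_cofinite]
  refine ((hU U hUy).preimage hinj.injOn).subset fun n hn => ?_
  exact ⟨(hinf.natEmbedding A n).2, hn⟩

lemma mem_seqClosure_of_subset_gammaAt {y : Y} {A D : Set Y} (hAD : A ⊆ D)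
    (hA : A ∈ GammaAt y) : y ∈ seqClosure D := by
  obtain ⟨b, hb, hlim⟩ := exists_tendsto_of_mem_gammaAt hA
  exact ⟨b, fun n => hAD (hb n), hlim⟩

lemma stronglySeqDenseInItself_of_selFin_seqDense
    (h : SelFin (DenseSets Y) (SeqDenseSets Y)) : StronglySeqDenseInItself Y := by
  intro D hD
  obtain ⟨B, hBD, -, hB⟩ := h.exists_countable_subset hD
  refine Set.eq_univ_of_forall fun y => ?_
  obtain ⟨b, hb, hlim⟩ : y ∈ seqClosure B := by
    rw [show seqClosure B = Set.univ from hB]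
    trivial
  exact ⟨b, fun n => hBD (hb n), hlim⟩

lemma separableSpace_of_selFin_seqDense
    (h : SelFin (DenseSets Y) (SeqDenseSets Y)) : TopologicalSpace.SeparableSpace Y := by
  obtain ⟨B, -, hc, hB⟩ := h.exists_countable_subset (A := Set.univ) dense_univ
  refine ⟨B, hc, fun y => seqClosure_subset_closure ?_⟩
  rw [show seqClosure B = Set.univ from hB]
  trivial

lemma stronglySeqDenseInItself_of_selFin_dense_gammaAt
    (h : ∀ y : Y, SelFin (DenseSets Y) (GammaAt y)) : StronglySeqDenseInItself Y := by
  intro D hD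
  refine Set.eq_univ_of_forall fun y => ?_
  obtain ⟨B, hBD, -, hB⟩ := (h y).exists_countable_subset hD
  exact mem_seqClosure_of_subset_gammaAt hBD hB

lemma stronglySeqDenseInItself_of_selFin_omegaAt_gammaAt
    (h : ∀ y : Y, SelFin (OmegaAt y) (GammaAt y)) : StronglySeqDenseInItself Y := by
  intro D hD
  refine Set.eq_univ_of_forall fun y => ?_
  by_cases hy : y ∈ D
  · exact subset_seqClosure hy
  · obtain ⟨B, hBD, -, hB⟩ := (h y).exists_countable_subset (A := D) ⟨hD y, hy⟩
    exact mem_seqClosure_of_subset_gammaAt hBD hB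

end Convergence

/-- Every sequence `𝒰 n` of families of open sets (the whole space being allowed as a member) such
that each finite set lies in a member of each `𝒰 n` has a selection whose members eventually
contain each point. -/
def EventualSelection (X : Type u) [TopologicalSpace X] : Prop :=
  ∀ 𝒰 : ℕ → Set (Set X), (∀ n, ∀ U ∈ 𝒰 n, IsOpen U) →
    (∀ n, ∀ F : Set X, F.Finite → ∃ U ∈ 𝒰 n, F ⊆ U) →
    ∃ U : ℕ → Set X, (∀ n, U n ∈ 𝒰 n) ∧ ∀ x, ∀ᶠ n in atTop, x ∈ U n

/-- Every open `ω`-cover contains a `γ`-cover. -/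
def GammaProperty (X : Type u) [TopologicalSpace X] : Prop :=
  ∀ 𝒰 ∈ OmegaCovers X, ∃ 𝒱 ⊆ 𝒰, 𝒱 ∈ GammaCovers X

/-! ### ω-covers and γ-covers -/

section Covers

variable {X : Type u} [TopologicalSpace X]

lemma range_mem_gammaCovers {U : ℕ → Set X} (ho : ∀ n, IsOpen (U n))
    (hne : ∀ n, U n ≠ Set.univ) (h : ∀ x, ∀ᶠ n in atTop, x ∈ U n) :
    Set.range U ∈ GammaCovers X := by
  refine ⟨⟨?_, ?_, ?_⟩, ?_, fun x => ?_⟩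
  · rintro _ ⟨n, rfl⟩
    exact ho n
  · refine Set.eq_univ_of_forall fun x => ?_
    obtain ⟨n, hn⟩ := (h x).exists
    exact ⟨_, ⟨n, rfl⟩, hn⟩
  · rintro ⟨n, hn⟩
    exact hne n hn
  · intro hfin
    have hex : ∀ n, ∃ x, x ∉ U n := fun n => (Set.ne_univ_iff_exists_notMem _).1 (hne n)
    -- One missed point per member: were the range finite, some `U n` would contain all these
    -- points, including its own. The point is arbitrary for sets outside the range.
    have hex' : ∀ V : Set X, ∃ x, V ∈ Set.range U → x ∉ V := fun V => by
      by_cases hV : V ∈ Set.range U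
      · obtain ⟨n, rfl⟩ := hV
        exact (hex n).imp fun x hx _ => hx
      · exact ⟨(hex 0).choose, fun h => absurd h hV⟩
    choose p hp using hex'
    have := (Filter.eventually_all_finite hfin).2 fun V _ => h (p V)
    obtain ⟨n, hn⟩ := this.exists
    exact hp (U n) ⟨n, rfl⟩ (hn (U n) ⟨n, rfl⟩)
  · have hx : {n | x ∉ U n}.Finite := by
      have := h x
      rwa [← Nat.cofinite_eq_atTop, Filter.eventually_cofinite] at this
    refine (hx.image U).subset ?_
    rintro _ ⟨⟨n, rfl⟩, hn⟩
    exact ⟨n, hn, rfl⟩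

lemma SelFin.gammaProperty (h : SelFin (OmegaCovers X) (GammaCovers X)) : GammaProperty X := by
  intro 𝒰 h𝒰
  obtain ⟨𝒱, hsub, -, h𝒱⟩ := h.exists_countable_subset h𝒰
  exact ⟨𝒱, hsub, h𝒱⟩

lemma EventualSelection.selOne (h : EventualSelection X) :
    SelOne (OmegaCovers X) (GammaCovers X) := by
  intro A hA
  obtain ⟨U, hU, hx⟩ := h A (fun n => (hA n).1.1) (fun n => (hA n).2)
  refine ⟨U, hU, range_mem_gammaCovers (fun n => (hA n).1.1 _ (hU n)) (fun n hn => ?_) hx⟩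
  exact (hA n).1.2.2 (hn ▸ hU n)

/-- A member of `𝒲` codes choices from `𝒰 0`, ..., `𝒰 n` at once. Deleting `p n` keeps the whole
space out of `𝒲` and forces the levels `n` to be unbounded along a γ-subcover, so every index gets a
choice. -/
lemma GammaProperty.eventualSelection [T1Space X] (h : GammaProperty X) :
    EventualSelection X := by
  intro 𝒰 ho hω
  cases finite_or_infinite X with
  | inl hfin =>
    choose U hU hsub using fun n => hω n Set.univ Set.finite_univ
    exact ⟨U, hU, fun x => Eventually.of_forall fun n => hsub n trivial⟩
  | inr hinf =>
    let p := Infinite.natEmbedding X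
    let 𝒲 : Set (Set X) := {V | ∃ n, ∃ u : ℕ → Set X, (∀ i, u i ∈ 𝒰 i) ∧
      V = (⋂ i ∈ Set.Iic n, u i) \ {p n}}
    have hfin𝒲 : ∀ F : Set X, F.Finite → ∃ V ∈ 𝒲, F ⊆ V := by
      intro F hF
      obtain ⟨n, hn⟩ := (hF.preimage p.injective.injOn).exists_notMem
      choose u hu hsub using fun i => hω i F hF
      refine ⟨_, ⟨n, u, hu, rfl⟩, fun x hx => ⟨?_, ?_⟩⟩
      · exact Set.mem_iInter₂.2 fun i _ => hsub i hx
      · rintro rfl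
        exact hn hx
    have h𝒲 : 𝒲 ∈ OmegaCovers X := by
      refine ⟨⟨?_, ?_, ?_⟩, hfin𝒲⟩
      · rintro _ ⟨n, u, hu, rfl⟩
        exact ((Set.finite_Iic n).isOpen_biInter fun i _ => ho i _ (hu i)).sdiff
          isClosed_singleton
      · refine Set.eq_univ_of_forall fun x => ?_
        obtain ⟨V, hV, hx⟩ := hfin𝒲 {x} (Set.finite_singleton x)
        exact ⟨V, hV, hx rfl⟩
      · rintro ⟨n, u, -, hV⟩
        have : p n ∈ (⋂ i ∈ Set.Iic n, u i) \ {p n} := hV ▸ Set.mem_univ _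
        exact this.2 rfl
    obtain ⟨𝒱, hsub, -, hinf𝒱, hγ⟩ := h 𝒲 h𝒲
    let e : ℕ → Set X := fun k => hinf𝒱.natEmbedding 𝒱 k
    have he : ∀ k, e k ∈ 𝒱 := fun k => (hinf𝒱.natEmbedding 𝒱 k).2
    have heinj : Function.Injective e :=
      Subtype.val_injective.comp (hinf𝒱.natEmbedding 𝒱).injective
    have hev : ∀ x, ∀ᶠ k in atTop, x ∈ e k := by
      intro x
      rw [← Nat.cofinite_eq_atTop, Filter.eventually_cofinite]
      exact ((hγ x).preimage heinj.injOn).subset fun k hk => ⟨he k, hk⟩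
    choose N u hu heq using fun k => hsub (he k)
    -- Late `e k` contain `p j` for all `j < i`, whereas `e k` omits `p (N k)`.
    have hN : ∀ i, ∃ k, i ≤ k ∧ i ≤ N k := by
      intro i
      have h1 : ∀ᶠ k in atTop, ∀ j ∈ Set.Iio i, p j ∈ e k :=
        (Filter.eventually_all_finite (Set.finite_Iio i)).2 fun j _ => hev (p j)
      obtain ⟨k, hk, hik⟩ := (h1.and (eventually_ge_atTop i)).exists
      refine ⟨k, hik, not_lt.1 fun hlt => ?_⟩
      have := hk (N k) hlt
      rw [heq k] at this
      exact this.2 rfl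
    choose k hk hNk using hN
    refine ⟨fun i => u (k i) i, fun i => hu _ i, fun x => ?_⟩
    obtain ⟨K, hK⟩ := eventually_atTop.1 (hev x)
    filter_upwards [eventually_ge_atTop K] with i hi
    have := hK (k i) (hi.trans (hk i))
    rw [heq] at this
    exact Set.mem_iInter₂.1 this.1 i (hNk i)

end Covers

/-! ### Passing between covers of the space and its function space -/

section FunctionSpace

variable {X : Type u} [TopologicalSpace X]

lemma Cp.tendsto_iff {ι : Type*} {l : Filter ι} {b : ι → Cp X} {f : Cp X} :
    Tendsto b l (𝓝 f) ↔ ∀ x, Tendsto (fun i => (b i).1 x) l (𝓝 (f.1 x)) := by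
  rw [tendsto_subtype_rng, tendsto_pi_nhds]

lemma Cp.mem_closure_iff {A : Set (Cp X)} {f : Cp X} :
    f ∈ closure A ↔
      ∀ F : Set X, F.Finite → ∀ ε > 0, ∃ g ∈ A, ∀ x ∈ F, dist (g.1 x) (f.1 x) < ε := by
  constructor
  · intro hf F hF ε hε
    have hU : {g : Cp X | ∀ x ∈ F, dist (g.1 x) (f.1 x) < ε} ∈ 𝓝 f := by
      refine (Filter.eventually_all_finite hF).2 fun x _ => ?_
      have hc : Tendsto (fun g : Cp X => g.1 x) (𝓝 f) (𝓝 (f.1 x)) :=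
        ((continuous_apply x).comp continuous_subtype_val).continuousAt
      exact hc.eventually (Metric.ball_mem_nhds _ hε)
    obtain ⟨g, hg, hgA⟩ := mem_closure_iff_nhds.1 hf _ hU
    exact ⟨g, hgA, hg⟩
  · intro h
    rw [mem_closure_iff_nhds]
    intro U hU
    obtain ⟨W, hW, hWU⟩ := mem_nhds_subtype _ _ _ |>.1 hU
    rw [nhds_pi, Filter.mem_pi] at hW
    obtain ⟨F, hF, t, ht, htW⟩ := hW
    have hε : ∀ᶠ ε in 𝓝[>] (0 : ℝ), ∀ x ∈ F, Metric.ball (f.1 x) ε ⊆ t x := by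
      refine (Filter.eventually_all_finite hF).2 fun x _ => ?_
      obtain ⟨δ, hδ, hsub⟩ := Metric.mem_nhds_iff.1 (ht x)
      filter_upwards [Ioo_mem_nhdsGT hδ] with ε hε
      exact (Metric.ball_subset_ball hε.2.le).trans hsub
    obtain ⟨ε, hsub, hpos⟩ := (hε.and self_mem_nhdsWithin).exists
    obtain ⟨g, hgA, hg⟩ := h F hF ε hpos
    exact ⟨g, hWU (htW fun x hx => hsub x hx (hg x hx)), hgA⟩

/-- Small constant shifts of `f` approach it, so a dense set stays dense after `f` is removed. -/
instance Cp.neBot_nhdsWithin_compl_singleton [Nonempty X] (f : Cp X) : NeBot (𝓝[≠] f) := by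
  refine mem_closure_iff_nhdsWithin_neBot.1 (Cp.mem_closure_iff.2 fun F _ ε hε => ?_)
  refine ⟨⟨fun x => f.1 x + ε / 2, f.2.add continuous_const⟩, fun h => ?_, fun x _ => ?_⟩
  · have := congrFun (congrArg Subtype.val h) (Classical.arbitrary X)
    simp only at this
    linarith
  · rw [Real.dist_eq, add_sub_cancel_left, abs_of_pos (half_pos hε)]
    exact half_lt_self hε

/-- The cover at stage `n` consists of the sets where some `g ∈ A n` is within `1 / (n + 1)` of `f`.
Such a set may be all of `X`, which is why `EventualSelection` admits the whole space. -/
lemma EventualSelection.exists_tendsto (h : EventualSelection X) {f : Cp X}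
    {A : ℕ → Set (Cp X)} (hA : ∀ n, f ∈ closure (A n)) :
    ∃ b : ℕ → Cp X, (∀ n, b n ∈ A n) ∧ Tendsto b atTop (𝓝 f) := by
  let δ : ℕ → ℝ := fun n => 1 / ((n : ℝ) + 1)
  have hδ : ∀ n, 0 < δ n := fun n => Nat.one_div_pos_of_nat
  let 𝒰 : ℕ → Set (Set X) := fun n => (fun g : Cp X => {x | dist (g.1 x) (f.1 x) < δ n}) '' A n
  have ho : ∀ n, ∀ U ∈ 𝒰 n, IsOpen U := by
    rintro n _ ⟨g, -, rfl⟩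
    exact isOpen_lt (g.2.dist f.2) continuous_const
  have hω : ∀ n, ∀ F : Set X, F.Finite → ∃ U ∈ 𝒰 n, F ⊆ U := by
    intro n F hF
    obtain ⟨g, hg, hgF⟩ := Cp.mem_closure_iff.1 (hA n) F hF (δ n) (hδ n)
    exact ⟨_, ⟨g, hg, rfl⟩, hgF⟩
  obtain ⟨U, hU, hx⟩ := h 𝒰 ho hω
  choose b hb hbU using hU
  refine ⟨b, hb, Cp.tendsto_iff.2 fun x => ?_⟩
  rw [tendsto_iff_dist_tendsto_zero]
  refine squeeze_zero' (Eventually.of_forall fun n => dist_nonneg) ?_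
    tendsto_one_div_add_atTop_nhds_zero_nat
  filter_upwards [hx x] with n hn
  rw [← hbU n] at hn
  exact le_of_lt hn

lemma EventualSelection.selOne_omegaAt_gammaAt (h : EventualSelection X) (f : Cp X) :
    SelOne (OmegaAt f) (GammaAt f) := by
  intro A hA
  obtain ⟨b, hb, hlim⟩ := h.exists_tendsto fun n => (hA n).1
  exact ⟨b, hb, range_mem_gammaAt (fun n hn => (hA n).2 (hn ▸ hb n)) hlim⟩

lemma EventualSelection.selOne_dense_gammaAt [Nonempty X] (h : EventualSelection X) (f : Cp X) :
    SelOne (DenseSets (Cp X)) (GammaAt f) := by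
  intro A hA
  obtain ⟨b, hb, hr⟩ := h.selOne_omegaAt_gammaAt f (fun n => A n \ {f})
    fun n => ⟨(Dense.sdiff_singleton (hA n) f) f, fun hf => hf.2 rfl⟩
  exact ⟨b, fun n => (hb n).1, hr⟩

lemma EventualSelection.selOne_dense_seqDense [TopologicalSpace.SeparableSpace (Cp X)]
    (h : EventualSelection X) : SelOne (DenseSets (Cp X)) (SeqDenseSets (Cp X)) := by
  intro A hA
  have : Nonempty (Cp X) := ⟨⟨fun _ => 0, continuous_const⟩⟩
  let d := TopologicalSpace.denseSeq (Cp X)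
  -- Pairing splits the sequence `A` into infinitely many subsequences; the `k`-th provides
  -- selections tending to `d k`, so together they are dense. A second use of `exists_tendsto` makes
  -- them sequentially dense.
  choose b hb hlim using fun k =>
    h.exists_tendsto (f := d k) (A := fun m => A (Nat.pair k m)) fun m => hA _ _
  refine ⟨fun n => b n.unpair.1 n.unpair.2, fun n => ?_, ?_⟩
  · simpa using hb n.unpair.1 n.unpair.2
  · have hd : Dense (Set.range fun n : ℕ => b n.unpair.1 n.unpair.2) := by
      refine dense_closure.1 ((TopologicalSpace.denseRange_denseSeq (Cp X)).mono ?_)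
      rintro _ ⟨k, rfl⟩
      refine mem_closure_of_tendsto (hlim k) (Eventually.of_forall fun m => ⟨Nat.pair k m, ?_⟩)
      simp
    refine Set.eq_univ_of_forall fun f => ?_
    obtain ⟨c, hc, hcf⟩ := h.exists_tendsto (f := f) fun _ => hd f
    exact ⟨c, hc, hcf⟩

lemma exists_continuous_zero_on_finite_one_on_closed [CompletelyRegularSpace X] {F K : Set X}
    (hF : F.Finite) (hK : IsClosed K) (hd : ∀ x ∈ F, x ∉ K) :
    ∃ φ : X → ℝ, Continuous φ ∧ (∀ x ∈ F, φ x = 0) ∧ ∀ x ∈ K, φ x = 1 := by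
  induction F, hF using Set.Finite.induction_on with
  | empty => exact ⟨fun _ => 1, continuous_const, by simp, fun _ _ => rfl⟩
  | @insert a F _ _ ih =>
    obtain ⟨φ, hφ, h0, h1⟩ := ih fun x hx => hd x (Set.mem_insert_of_mem _ hx)
    obtain ⟨ψ, hψ, hψ0, hψ1⟩ :=
      CompletelyRegularSpace.completely_regular a K hK (hd a (Set.mem_insert _ _))
    refine ⟨fun x => φ x * (ψ x : ℝ), hφ.mul (continuous_subtype_val.comp hψ), ?_, ?_⟩
    · rintro x (rfl | hx)
      · simp [hψ0]
      · simp [h0 x hx]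
    · intro x hx
      simp [h1 x hx, hψ1 hx]

lemma StronglySeqDenseInItself.gammaProperty [CompletelyRegularSpace X]
    (h : StronglySeqDenseInItself (Cp X)) : GammaProperty X := by
  intro 𝒰 h𝒰
  let D : Set (Cp X) := {f | ∃ U ∈ 𝒰, ∀ x, x ∉ U → f.1 x = 1}
  have hD : Dense D := by
    intro g
    refine Cp.mem_closure_iff.2 fun F hF ε hε => ?_
    obtain ⟨U, hU, hFU⟩ := h𝒰.2 F hF
    obtain ⟨φ, hφ, h0, h1⟩ := exists_continuous_zero_on_finite_one_on_closed hF
      (h𝒰.1.1 U hU).isClosed_compl fun x hx hxU => hxU (hFU hx)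
    -- Interpolates between `g` on `F`, where `φ = 0`, and 1 off `U`, where `φ = 1`.
    refine ⟨⟨fun x => g.1 x + φ x * (1 - g.1 x),
      g.2.add (hφ.mul (continuous_const.sub g.2))⟩, ⟨U, hU, fun x hx => ?_⟩, fun x hx => ?_⟩
    · simp [h1 x hx]
    · simpa [h0 x hx] using hε
  obtain ⟨b, hb, hlim⟩ : (⟨fun _ => 0, continuous_const⟩ : Cp X) ∈ seqClosure D := by
    rw [show seqClosure D = Set.univ from h D hD]
    trivial
  choose U hU hbU using hb
  refine ⟨Set.range U, Set.range_subset_iff.2 hU, range_mem_gammaCovers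
    (fun n => h𝒰.1.1 _ (hU n)) (fun n hn => h𝒰.1.2.2 (hn ▸ hU n)) fun x => ?_⟩
  filter_upwards [(Cp.tendsto_iff.1 hlim x).eventually (gt_mem_nhds one_pos)] with n hn
  by_contra hx
  exact hn.ne (hbU n x hx)

end FunctionSpace

/-! ### Countable `i`-weight and separability of the function space -/

section Weight

lemma topWeight_le_aleph0_iff {Y : Type u} [TopologicalSpace Y] :
    topWeight Y ≤ ℵ₀ ↔ SecondCountableTopology Y := by
  constructor
  · intro h
    have hne : {κ | ∃ B : Set (Set Y), TopologicalSpace.IsTopologicalBasis B ∧ #B = κ}.Nonempty :=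
      ⟨_, _, TopologicalSpace.isTopologicalBasis_opens, rfl⟩
    obtain ⟨B, hB, hcard⟩ := csInf_mem hne
    refine hB.secondCountableTopology ?_
    rw [← Cardinal.le_aleph0_iff_set_countable, hcard]
    exact h
  · intro h
    refine (csInf_le' ⟨TopologicalSpace.countableBasis Y, TopologicalSpace.isBasis_countableBasis Y, rfl⟩ :
      topWeight Y ≤ #(TopologicalSpace.countableBasis Y)).trans ?_
    exact Cardinal.le_aleph0_iff_set_countable.2 (TopologicalSpace.countable_countableBasis Y)

lemma iWeight_eq_aleph0_iff {X : Type u} [TopologicalSpace X] :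
    iWeight X = ℵ₀ ↔ ∃ (Y : Type u) (_ : TopologicalSpace Y) (f : X → Y),
      T35Space Y ∧ Continuous f ∧ Function.Bijective f ∧ SecondCountableTopology Y := by
  constructor
  · intro h
    have hne : {τ : Cardinal.{u} | ℵ₀ ≤ τ ∧ ∃ (Y : Type u) (_ : TopologicalSpace Y)
        (f : X → Y), T35Space Y ∧ Continuous f ∧ Function.Bijective f ∧
          topWeight Y ≤ τ}.Nonempty := by
      rw [Set.nonempty_iff_ne_empty]
      -- The infimum of the empty set of cardinals is 0, so the value `ℵ₀` rules it out.
      intro h0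
      rw [iWeight, h0, Cardinal.sInf_empty] at h
      exact Cardinal.aleph0_ne_zero h.symm
    obtain ⟨-, Y, tY, f, hY, hf, hbij, hw⟩ := csInf_mem hne
    exact ⟨Y, tY, f, hY, hf, hbij, topWeight_le_aleph0_iff.1 (hw.trans h.le)⟩
  · rintro ⟨Y, tY, f, hY, hf, hbij, hw⟩
    have hmem : ℵ₀ ∈ {τ : Cardinal.{u} | ℵ₀ ≤ τ ∧ ∃ (Y : Type u) (_ : TopologicalSpace Y)
        (f : X → Y), T35Space Y ∧ Continuous f ∧ Function.Bijective f ∧ topWeight Y ≤ τ} :=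
      ⟨le_rfl, Y, tY, f, hY, hf, hbij, topWeight_le_aleph0_iff.2 hw⟩
    exact le_antisymm (csInf_le' hmem) (le_csInf ⟨_, hmem⟩ fun τ hτ => hτ.1)

/-- Evaluation at a dense sequence of functions is a continuous injection into `ℕ → ℝ`; the coarser
topology it induces on `X` is the required one. -/
lemma iWeight_eq_aleph0_of_separableSpace_cp {X : Type u} [TopologicalSpace X] [T35Space X]
    [TopologicalSpace.SeparableSpace (Cp X)] : iWeight X = ℵ₀ := by
  have : Nonempty (Cp X) := ⟨⟨fun _ => 0, continuous_const⟩⟩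
  let d := TopologicalSpace.denseSeq (Cp X)
  let ev : X → ℕ → ℝ := fun x n => (d n).1 x
  have hev : Continuous ev := continuous_pi fun n => (d n).2
  have hinj : Function.Injective ev := by
    intro x y hxy
    by_contra hne
    obtain ⟨φ, hφ, h0, h1⟩ := exists_continuous_zero_on_finite_one_on_closed
      (Set.finite_singleton x) (isClosed_singleton (x := y)) (by simpa using hne)
    obtain ⟨_, ⟨n, rfl⟩, hn⟩ := Cp.mem_closure_iff.1
      (TopologicalSpace.denseRange_denseSeq (Cp X) ⟨φ, hφ⟩) {x, y} (Set.toFinite _) (1 / 2)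
      (by norm_num)
    have hx := hn x (by simp)
    have hy := hn y (by simp)
    have hxy' : (d n).1 x = (d n).1 y := congrFun hxy n
    simp only [h0 x rfl, h1 y rfl, Real.dist_eq] at hx hy
    change |(d n).1 x - 0| < 1 / 2 at hx
    change |(d n).1 y - 1| < 1 / 2 at hy
    rw [abs_lt] at hx hy
    linarith [hx.2, hy.1]
  refine iWeight_eq_aleph0_iff.2 ⟨X, TopologicalSpace.induced ev inferInstance, id, ?_, ?_,
    Function.bijective_id, ?_⟩
  · let _ : TopologicalSpace X := TopologicalSpace.induced ev inferInstance
    exact Topology.IsEmbedding.t35Space ⟨⟨rfl⟩, hinj⟩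
  · exact continuous_id_iff_le.2 hev.le_induced
  · exact TopologicalSpace.secondCountableTopology_induced X (ℕ → ℝ) ev

lemma exists_continuous_ne_zero_iff_mem {Y : Type*} [TopologicalSpace Y]
    [TopologicalSpace.MetrizableSpace Y] {U : Set Y} (hU : IsOpen U) :
    ∃ φ : Y → ℝ, Continuous φ ∧ ∀ y, φ y ≠ 0 ↔ y ∈ U := by
  let _ := TopologicalSpace.metrizableSpaceMetric Y
  obtain h | h := Uᶜ.eq_empty_or_nonempty
  · refine ⟨fun _ => 1, continuous_const, fun y => ?_⟩
    simp [Set.compl_empty_iff.1 h]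
  · refine ⟨fun y => Metric.infDist y Uᶜ, Metric.continuous_infDist_pt _, fun y => ?_⟩
    rw [Ne, ← hU.isClosed_compl.mem_iff_infDist_zero h, Set.mem_compl_iff, not_not]

lemma exists_rat_dist_mul_lt {a : ℝ} (ha : a ≠ 0) (r : ℝ) {ε : ℝ} (hε : 0 < ε) :
    ∃ q : ℚ, dist ((q : ℝ) * a) r < ε := by
  have hpos : 0 < |a| := abs_pos.2 ha
  obtain ⟨q, hq⟩ := (Rat.denseRange_cast (𝕜 := ℝ)).exists_dist_lt (r / a) (div_pos hε hpos)
  refine ⟨q, ?_⟩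
  rw [dist_comm, Real.dist_eq] at hq
  rw [Real.dist_eq, show (q : ℝ) * a - r = (q - r / a) * a by field_simp, abs_mul]
  exact (lt_div_iff₀ hpos).1 hq

/-- The countable dense set is made of rational combinations of functions `φ U ∘ p`, with `φ U`
nonzero exactly on the basic set `U`. Basic sets isolating the points of `F` leave one term alive at
each point. -/
lemma separableSpace_cp_of_iWeight_eq_aleph0 {X : Type u} [TopologicalSpace X]
    (h : iWeight X = ℵ₀) : TopologicalSpace.SeparableSpace (Cp X) := by
  obtain ⟨Y, _, p, _, hp, hbij, _⟩ := iWeight_eq_aleph0_iff.1 h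
  let B := TopologicalSpace.countableBasis Y
  have hB := TopologicalSpace.isBasis_countableBasis Y
  choose φ hφ hφU using fun U : B => exists_continuous_ne_zero_iff_mem (hB.isOpen U.2)
  let L : (B →₀ ℚ) → Cp X := fun c => ⟨fun x => c.sum fun U q => (q : ℝ) * φ U (p x),
    continuous_finsetSum _ fun U _ => continuous_const.mul ((hφ U).comp hp)⟩
  have : Countable B := (TopologicalSpace.countable_countableBasis Y).to_subtype
  refine ⟨Set.range L, Set.countable_range L, fun f => Cp.mem_closure_iff.2 fun F hF ε hε => ?_⟩
  have hU : ∀ x, ∃ U : B, p x ∈ U.1 ∧ ∀ y ∈ F, p y ∈ U.1 → y = x := by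
    intro x
    have ho : IsOpen (p '' (F \ {x}))ᶜ := ((hF.sdiff).image p).isClosed.isOpen_compl
    have hx : p x ∈ (p '' (F \ {x}))ᶜ := by
      rintro ⟨y, hy, hyx⟩
      exact hy.2 (hbij.1 hyx)
    obtain ⟨U, hUB, hxU, hsub⟩ := hB.exists_subset_of_mem_open hx ho
    refine ⟨⟨U, hUB⟩, hxU, fun y hy hyU => ?_⟩
    by_contra hne
    exact hsub hyU ⟨y, ⟨hy, hne⟩, rfl⟩
  choose U hxU hyU using hU
  choose q hq using fun x =>
    exists_rat_dist_mul_lt ((hφU (U x) (p x)).2 (hxU x)) (f.1 x) hε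
  refine ⟨L (∑ x ∈ hF.toFinset, Finsupp.single (U x) (q x)), ⟨_, rfl⟩, fun y hy => ?_⟩
  have hval : (L (∑ x ∈ hF.toFinset, Finsupp.single (U x) (q x))).1 y
      = (q y : ℝ) * φ (U y) (p y) := by
    change Finsupp.sum (∑ x ∈ hF.toFinset, Finsupp.single (U x) (q x))
      (fun (U : B) (r : ℚ) => (r : ℝ) * φ U (p y)) = _
    rw [← Finsupp.sum_finsetSum_index (h := fun (U : B) (q : ℚ) => (q : ℝ) * φ U (p y))
      (fun _ => by simp) (fun _ _ _ => by push_cast; ring)]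
    simp only [Rat.cast_zero, zero_mul, Finsupp.sum_single_index]
    refine Finset.sum_eq_single y (fun x _ hxy => ?_) fun hny => ?_
    · have : φ (U x) (p y) = 0 := by
        by_contra hne
        exact hxy (hyU x y hy ((hφU _ _).1 hne)).symm
      rw [this, mul_zero]
    · exact absurd (hF.mem_toFinset.2 hy) hny
  rw [hval]
  exact hq y

end Weight

/-! ### The implications between the nine conditions -/

theorem mainTheorem1 (X : Type u) [TopologicalSpace X] [T35Space X] [Nonempty X] :
    List.TFAE [
      SelOne (DenseSets (Cp X)) (SeqDenseSets (Cp X)),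
      StronglySeqDenseInItself (Cp X) ∧ TopologicalSpace.SeparableSpace (Cp X),
      SelOne (OmegaCovers X) (GammaCovers X) ∧ iWeight X = ℵ₀,
      (∀ f : Cp X, SelOne (OmegaAt f) (GammaAt f)) ∧ TopologicalSpace.SeparableSpace (Cp X),
      (∀ f : Cp X, SelOne (DenseSets (Cp X)) (GammaAt f)) ∧
        TopologicalSpace.SeparableSpace (Cp X),
      SelFin (DenseSets (Cp X)) (SeqDenseSets (Cp X)),
      SelFin (OmegaCovers X) (GammaCovers X) ∧ iWeight X = ℵ₀,
      (∀ f : Cp X, SelFin (OmegaAt f) (GammaAt f)) ∧ TopologicalSpace.SeparableSpace (Cp X),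
      (∀ f : Cp X, SelFin (DenseSets (Cp X)) (GammaAt f)) ∧
        TopologicalSpace.SeparableSpace (Cp X)] := by
  tfae_have 1 → 6 := SelOne.selFin
  tfae_have 3 → 7 := fun h => ⟨h.1.selFin, h.2⟩
  tfae_have 4 → 8 := fun h => ⟨fun f => (h.1 f).selFin, h.2⟩
  tfae_have 5 → 9 := fun h => ⟨fun f => (h.1 f).selFin, h.2⟩
  tfae_have 6 → 2 := fun h =>
    ⟨stronglySeqDenseInItself_of_selFin_seqDense h, separableSpace_of_selFin_seqDense h⟩
  tfae_have 8 → 2 := fun h => ⟨stronglySeqDenseInItself_of_selFin_omegaAt_gammaAt h.1, h.2⟩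
  tfae_have 9 → 2 := fun h => ⟨stronglySeqDenseInItself_of_selFin_dense_gammaAt h.1, h.2⟩
  tfae_have 2 → 3 := fun ⟨h, _⟩ =>
    ⟨h.gammaProperty.eventualSelection.selOne, iWeight_eq_aleph0_of_separableSpace_cp⟩
  tfae_have 7 → 1 := fun ⟨h, hw⟩ =>
    have := separableSpace_cp_of_iWeight_eq_aleph0 hw
    h.gammaProperty.eventualSelection.selOne_dense_seqDense
  tfae_have 7 → 4 := fun ⟨h, hw⟩ =>
    ⟨h.gammaProperty.eventualSelection.selOne_omegaAt_gammaAt,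
      separableSpace_cp_of_iWeight_eq_aleph0 hw⟩
  tfae_have 7 → 5 := fun ⟨h, hw⟩ =>
    ⟨h.gammaProperty.eventualSelection.selOne_dense_gammaAt,
      separableSpace_cp_of_iWeight_eq_aleph0 hw⟩
  tfae_finish
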